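/- **Setting.** For $L\in\mathbb N$ let $\mathcal V_L=\{0,\dots,L-1\}$ be the sites of the cycle (ring) with edges $\{j,(j+1)\bmod L\}$, and let $d_L$ be its graph distance. For $N\in\mathbb N$ let $\mathcal V_L^N$ be the set of $N$-element subsets of $\mathcal V_L$ ("$N$-particle configurations"), made into a graph by joining $x$ and $x'$ whenever the symmetric difference $x\triangle x'$ is an edge of the ring; let $d_L^N$ be its graph distance. The elements of a configuration $x$ are written $x_1<x_2<\dots<x_N$. For $m\in\mathcal V_L$ the droplet centered at $m$ is $$c_{L,m}^N=\Big\{(m+j)\bmod L:\ -\Big\lfloor\tfrac{N-1}{2}\Big\rfloor\le j\le\Big\lceil\tfrac{N-1}{2}\Big\rceil\Big\},$$ $\mathcal V_{L,1}^N=\{c_{L,m}^N: m\in\mathcal V_L\}$ is the set of droplets, $d_L^N(x,\mathcal V_{L,1}^N)=\min_{c\in\mathcal V_{L,1}^N}d_L^N(x,c)$, and $$\mathcal W_L(x)=\{m\in\mathcal V_L:\ d_L^N(x,c_{L,m}^N)=d_L^N(x,\mathcal V_{L,1}^N)\}$$ is the set of closest droplet centers. The negligible configurations are $\mathcal C_L^N=\{x\in\mathcal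 V_L^N: d_L^N(x,\mathcal V_{L,1}^N)\ge L^{3/2}\}$. With $M=\lfloor (L-1)/2\rfloor$ let $\mathcal S_{L,M}(\theta)=\{k\in\mathcal V_L: d_L(k,M)<\theta L\}$. A shortest path from $c$ to $x$ is a path $(v^{(0)},\dots,v^{(k)})$ in the graph $\mathcal V_L^N$ from $c$ to $x$ of length $k=d_L^N(c,x)$. Let $\epsilon\in(0,1/16)$, $\theta\in(\epsilon,1/16)$, $N=\lfloor\epsilon L\rfloor$, $\Lambda_L=\mathcal S_{L,M}(\theta)$, $\lambda_-=\min\Lambda_L$, $\lambda_+=\max\Lambda_L$ and $a_{\pm,j}=\lambda_\pm\pm j$. For $\ell,r\in\mathbb N_0$ put $$b_{\ell,r}=\{a_{-,j}:1\le j\le\ell\}\cup\{a_{+,j}:1\le j\le r\}.$$ For $x\in\mathcal V_L^N$ with $0<|x\cap\Lambda_L|<N$ and $\ell+r=N-|x\cap\Lambda_L|$, let $\sigma_{\ell,r}$ be the unique cyclic shift of $\{1,\dots,N\}$ with $x\cap\Lambda_L=\{x_{\sigma_{\ell,r}(j)}:\ell<j\le N-r\}$, and let $\chi_-^\ell\in\{0,\dots,L-1\}^\ell$,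 $\chi_+^r\in\{0,\dots,L-1\}^r$ be the unique nondecreasing sequences with $$x_{\sigma_{\ell,r}(\zeta)}=(a_{-,\ell-\zeta+1}-\chi^\ell_{-,\ell-\zeta+1})\bmod L\quad(1\le\zeta\le\ell),$$ $$x_{\sigma_{\ell,r}(N+1-\xi)}=(a_{+,r-\xi+1}+\chi^r_{+,r-\xi+1})\bmod L\quad(1\le\xi\le r).$$ **Lemma.** For every $\epsilon\in(0,1/16)$ there is an $L_0=L_0(\epsilon)>0$ such that the following holds for all $\theta\in(\epsilon,1/16)$ and all $L\ge L_0$. Let $n\in\mathbb N$ with $N/2<n<N$, let $y\subseteq\Lambda_L$ with $|y|=n$, and let $x\in\mathcal V_L^N\setminus\mathcal C_L^N$ with $x\cap\Lambda_L=y$. Put $\kappa=\lfloor(N+1)/2\rfloor$ and $k=d_L^N(x,\mathcal V_{L,1}^N)$. Then there exist $\ell,r\in\mathbb N_0$ with $\ell+r=N-n$ such that $1\le\kappa-\ell\le n$, $$y_{\kappa-\ell}\in\mathcal W_L(x)\qquad\text{and}\qquad c_{L,y_{\kappa-\ell}}^N\subseteq\mathcal S_{L,M}(1/4-\epsilon/2).$$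 Furthermore, there exist a shortest path $\mathbf v$ from $c_{L,y_{\kappa-\ell}}^N$ to $x$ and a $k_0\in\{0,\dots,k\}$ such that $$v^{(k_0)}=y\cup b_{\ell,r}\subseteq\mathcal S_{L,M}(1/4-\epsilon/2)\qquad\text{and}\qquad k-k_0=\sum_{\zeta=1}^{\ell}\chi^\ell_{-,\zeta}+\sum_{\xi=1}^{r}\chi^r_{+,\xi}.$$ -/

import Mathlib

namespace XXZRing

/-- The residue `j mod L`, as a site of the ring `{0, …, L - 1}`. -/
def resid (L : ℕ) [NeZero L] (j : ℤ) : Fin L := Fin.ofNat L (j % (L : ℤ)).toNat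

/-- The ring distance `d_L`: the graph distance of the cycle on the sites `{0, …, L - 1}`. -/
noncomputable def ringDist {L : ℕ} (a b : Fin L) : ℕ := (SimpleGraph.cycleGraph L).dist a b

/-- `N`-particle configurations on the ring: the `N`-element sets of sites. -/
abbrev Config (L N : ℕ) : Type := {x : Finset (Fin L) // x.card = N}

/-- The graph of `N`-particle configurations: two configurations are adjacent if and only if their
symmetric difference is an edge of the ring. -/
def configGraph (L N : ℕ) : SimpleGraph (Config L N) where
  Adj x y := ∃ a b : Fin L, (SimpleGraph.cycleGraph L).Adj a b ∧ symmDiff x.1 y.1 = {a, b}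
  symm := ⟨by
    rintro x y ⟨a, b, hab, h⟩
    exact ⟨a, b, hab, by rw [symmDiff_comm, h]⟩⟩
  loopless := ⟨by
    rintro x ⟨a, b, -, h⟩
    rw [symmDiff_self] at h
    exact (Finset.insert_ne_empty a {b}) h.symm⟩

/-- The graph distance `d_L^N` of configurations. -/
noncomputable def configDist {L N : ℕ} (x y : Config L N) : ℕ := (configGraph L N).dist x y

/-- The `N`-particle droplet on the ring centred at `m`: the residues of
`m + {-⌊(N - 1) / 2⌋, …, ⌈(N - 1) / 2⌉}` (note `⌈(N - 1) / 2⌉ = ⌊N / 2⌋`). -/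
noncomputable def droplet (L : ℕ) [NeZero L] (N : ℕ) (m : Fin L) : Finset (Fin L) :=
  (Finset.Icc (((m : ℕ) : ℤ) - ((N : ℤ) - 1) / 2) (((m : ℕ) : ℤ) + (N : ℤ) / 2)).image (resid L)

/-- The set of all `N`-particle droplet configurations. -/
noncomputable def dropletConfigs (L : ℕ) [NeZero L] (N : ℕ) : Set (Config L N) :=
  {c | ∃ m : Fin L, c.1 = droplet L N m}

/-- The distance of a configuration to the set of droplet configurations. -/
noncomputable def distToDroplets {L : ℕ} [NeZero L] {N : ℕ} (x : Config L N) : ℕ :=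
  sInf ((fun c => configDist x c) '' dropletConfigs L N)

/-- The set of centres of those droplets that are closest to `x`. -/
def closestCenters {L : ℕ} [NeZero L] {N : ℕ} (x : Config L N) : Set (Fin L) :=
  {m | ∃ c : Config L N, c.1 = droplet L N m ∧ configDist x c = distToDroplets x}

/-- The negligible configurations: those at distance at least `L ^ (3 / 2)` from all droplets. -/
def negligible (L : ℕ) [NeZero L] (N : ℕ) : Set (Config L N) :=
  {x | (L : ℝ) ^ (3 / 2 : ℝ) ≤ (distToDroplets x : ℝ)}

/-- The site `M = ⌊(L - 1) / 2⌋`. -/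
def midSite (L : ℕ) [NeZero L] : Fin L := Fin.ofNat L ((L - 1) / 2)

/-- The sector of size `θ` around the site `M`: all sites `k` with `d_L(k, M) < θ L`. -/
noncomputable def sector (L : ℕ) [NeZero L] (θ : ℝ) : Finset (Fin L) :=
  Finset.univ.filter fun k => (ringDist k (midSite L) : ℝ) < θ * (L : ℝ)

/-- The smallest site of a nonempty set of sites. -/
noncomputable def leftEnd {L : ℕ} (Γ : Finset (Fin L)) : ℕ := sInf {k | ∃ j ∈ Γ, (j : ℕ) = k}

/-- The largest site of a nonempty set of sites. -/
def rightEnd {L : ℕ} (Γ : Finset (Fin L)) : ℕ := Γ.sup fun j => (j : ℕ)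

/-- The boundary configuration `b_{ℓ,r}(Γ)`: the `ℓ` sites directly to the left of `Γ` and the
`r` sites directly to the right of `Γ`. -/
noncomputable def boundaryConfig {L : ℕ} [NeZero L] (Γ : Finset (Fin L)) (ℓ r : ℕ) :
    Finset (Fin L) :=
  (Finset.Icc 1 ℓ).image (fun j : ℕ => resid L ((leftEnd Γ : ℤ) - j)) ∪
    (Finset.Icc 1 r).image (fun j : ℕ => resid L ((rightEnd Γ : ℤ) + j))

/-- The particles `x_1 < x_2 < … < x_N` of a configuration, indexed from zero:
`particle x j` is `x_{j+1}`. -/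
def particle {L N : ℕ} (x : Config L N) (j : Fin N) : Fin L := x.1.orderEmbOfFin x.2 j

/-- `σ` is the cyclic permutation `σ_{ℓ,r}(x, Γ)`, and `χm`, `χp` are the displacements
`χ_-^ℓ(x, Γ)`, `χ_+^r(x, Γ)`. All indices are shifted by one, because `Fin` starts at zero:
`χm j` is `χ_{-,j+1}` and `χp j` is `χ_{+,j+1}`. For `0 < |x ∩ Γ| < N` and `ℓ + r + |x ∩ Γ| = N`,
where `Γ` is an interval, these data exist and are determined uniquely by the conditions below. -/
structure IsDisplacement {L : ℕ} [NeZero L] {N : ℕ} (x : Config L N) (Γ : Finset (Fin L))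
    (ℓ r : ℕ) (σ : Equiv.Perm (Fin N)) (χm : Fin ℓ → ℕ) (χp : Fin r → ℕ) : Prop where
  /-- `σ` is a cyclic shift of the labels. -/
  cyclic : σ ∈ Subgroup.zpowers (finRotate N)
  /-- The particles in `Γ` are exactly the `x_{σ(j)}` with `ℓ < j ≤ N - r`. -/
  inside : x.1 ∩ Γ =
    (Finset.univ.filter fun j : Fin N => ℓ ≤ (j : ℕ) ∧ (j : ℕ) + r < N).image
      fun j => particle x (σ j)
  monotone_left : Monotone χm
  monotone_right : Monotone χp
  lt_left : ∀ j, χm j < L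
  lt_right : ∀ j, χp j < L
  /-- `x_{σ(ζ)} = (a_{-,ℓ-ζ+1} - χ_{-,ℓ-ζ+1}) mod L` for `1 ≤ ζ ≤ ℓ`, where
  `a_{-,j} = min Γ - j`. -/
  left : ∀ (ζ : Fin N) (j : Fin ℓ), (ζ : ℕ) + (j : ℕ) + 1 = ℓ →
    particle x (σ ζ) = resid L ((leftEnd Γ : ℤ) - ((j : ℕ) + 1) - χm j)
  /-- `x_{σ(N+1-ξ)} = (a_{+,r-ξ+1} + χ_{+,r-ξ+1}) mod L` for `1 ≤ ξ ≤ r`, where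
  `a_{+,j} = max Γ + j`. -/
  right : ∀ (i : Fin N) (j : Fin r), (i : ℕ) + r = N + (j : ℕ) →
    particle x (σ i) = resid L ((rightEnd Γ : ℤ) + ((j : ℕ) + 1) + χp j)

end XXZRing

/-!
Configurations are lifted to the line: a lift of `x` consists of integers `Z 0 < … < Z (N - 1)` in a
window of length `L` whose residues are the particles of `x`. A step in the graph of configurations
moves one integer of a lift by one (`IsLift.exists_of_walk`). Conversely, two lifts `W` and `Z` are
joined by a walk of length `∑ |Z i - W i|`, provided that `W` has room at its seam, so that the
particles do not block each other all around the ring (`IsLift.exists_walk`). Since the droplets are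
lifted by intervals of integers, the distance of `x` to the droplets is the minimum of
`∑ |Z i - (m + i)|` over all lifts `Z` of `x` and all integers `m`.

For a given lift, the minimum over `m` is attained when the interval is aligned with the middle
particle of the lift (`IsWindow.sum_abs_median_le`), and this particle is then the centre of the
droplet. It remains to see that some optimal lift does not cut the sector `Λ`, that is, contains all
particles in `Λ` as one block (`IsLift.mem_Icc_of_minimal`). If it does cut `Λ`, then its first
particle is in `Λ` and its last one is in the next copy `Λ + L`. When the interval is near one of the
two copies, moving the particle at the far end to the other end of the lift decreases the sum. When
it is far from both, then all particles in `Λ`, more than half of the `N ≈ ε L` particles, are at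
distance at least `L / 4` from their targets, and the sum is of order `L ^ 2`, so that `x` is
negligible.

In an uncut lift, `ℓ` particles are to the left of `Λ` and `r` to the right of it. As these are fewer
than half of all particles, the middle particle is in `Λ`. Moving the outer particles next to `Λ`
gives a lift of `(x ∩ Λ) ∪ b_{ℓ,r}`, which is between the lift of `x` and the interval of the closest
droplet, particle by particle. Hence the distances add up (`IsSplit.sum_abs_add_sum_abs`), and
passing through this configuration costs nothing.
-/

namespace XXZRing

/-! ### Residues and the ring -/

lemma coe_resid (L : ℕ) [NeZero L] (j : ℤ) : (((resid L j : Fin L) : ℕ) : ℤ) = j % (L : ℤ) := by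
  have hL : (0 : ℤ) < L := by exact_mod_cast Nat.pos_of_neZero L
  have h0 := Int.emod_nonneg j hL.ne'
  have h1 := Int.emod_lt_of_pos j hL
  have h2 : (j % (L : ℤ)).toNat % L = (j % (L : ℤ)).toNat := Nat.mod_eq_of_lt (by omega)
  simp only [resid, Fin.ofNat, h2]
  omega

lemma resid_eq_resid_iff {L : ℕ} [NeZero L] {j k : ℤ} :
    resid L j = resid L k ↔ (L : ℤ) ∣ j - k := by
  rw [← Fin.val_inj, ← Int.natCast_inj, coe_resid, coe_resid]
  exact Int.emod_eq_emod_iff_emod_sub_eq_zero.trans Int.dvd_iff_emod_eq_zero.symm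

lemma resid_natCast_coe {L : ℕ} [NeZero L] (a : Fin L) : resid L ((a : ℕ) : ℤ) = a := by
  rw [← Fin.val_inj, ← Int.natCast_inj, coe_resid]
  have := a.isLt
  exact Int.emod_eq_of_lt (by omega) (by omega)

lemma coe_resid_of_mem {L : ℕ} [NeZero L] {j : ℤ} (h0 : 0 ≤ j) (h1 : j < L) :
    (((resid L j : Fin L) : ℕ) : ℤ) = j := by
  rw [coe_resid, Int.emod_eq_of_lt h0 h1]

lemma eq_of_resid_eq {L : ℕ} [NeZero L] {j k : ℤ} (h : resid L j = resid L k)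
    (h1 : j - k < L) (h2 : k - j < L) : j = k := by
  have := Int.eq_zero_of_abs_lt_dvd (resid_eq_resid_iff.1 h) (abs_lt.2 ⟨by omega, h1⟩)
  omega

lemma resid_add_mul {L : ℕ} [NeZero L] (j t : ℤ) : resid L (j + t * L) = resid L j :=
  resid_eq_resid_iff.2 ⟨t, by ring⟩

lemma resid_add_self {L : ℕ} [NeZero L] (j : ℤ) : resid L (j + L) = resid L j := by
  simpa using resid_add_mul (L := L) j 1

lemma resid_sub_self {L : ℕ} [NeZero L] (j : ℤ) : resid L (j - L) = resid L j := by
  simpa [sub_eq_add_neg] using resid_add_mul (L := L) j (-1)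

lemma resid_sub {L : ℕ} [NeZero L] (j k : ℤ) : resid L j - resid L k = resid L (j - k) := by
  have hL : (0 : ℤ) < L := by exact_mod_cast Nat.pos_of_neZero L
  rw [← Fin.val_inj, ← Int.natCast_inj, Fin.sub_def, coe_resid]
  simp only
  have hj := coe_resid L j
  have hk := coe_resid L k
  have hlt := (resid L k).isLt
  push_cast [Nat.cast_sub hlt.le]
  rw [hj, hk]
  have e1 := Int.emod_add_mul_ediv j L
  have e2 := Int.emod_add_mul_ediv k L
  rw [Int.emod_eq_emod_iff_emod_sub_eq_zero, ← Int.dvd_iff_emod_eq_zero]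
  refine ⟨1 - j / L + k / L, ?_⟩
  linear_combination e1 - e2

/-- Sites are adjacent on the ring exactly if they are residues of neighbouring integers. -/
lemma cycleGraph_adj_resid_iff {L : ℕ} [NeZero L] (hL : 2 ≤ L) {j : ℤ} {b : Fin L} :
    (SimpleGraph.cycleGraph L).Adj (resid L j) b ↔ ∃ z : ℤ, |z - j| = 1 ∧ resid L z = b := by
  have key : ∀ k : ℤ, ((resid L k : Fin L) : ℕ) = 1 ↔ (L : ℤ) ∣ k - 1 := by
    intro k
    rw [← resid_eq_resid_iff, ← Fin.val_inj, ← Int.natCast_inj, ← Int.natCast_inj,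
      coe_resid_of_mem (j := 1) (by omega) (by omega)]
    simp
  rw [← resid_natCast_coe b, SimpleGraph.cycleGraph_adj', resid_sub, resid_sub, key, key]
  constructor
  · rintro (⟨t, ht⟩ | ⟨t, ht⟩)
    · exact ⟨j - 1, by simp, resid_eq_resid_iff.2 ⟨t, by linarith⟩⟩
    · exact ⟨j + 1, by simp, resid_eq_resid_iff.2 ⟨-t, by linarith⟩⟩
  · rintro ⟨z, hz, h⟩
    obtain ⟨t, ht⟩ := resid_eq_resid_iff.1 h
    rcases (abs_eq (by norm_num)).1 hz with hz | hz
    · exact Or.inr ⟨-t, by linarith⟩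
    · exact Or.inl ⟨t, by linarith⟩

/-- A walk on the ring lifts to the integers. -/
lemma exists_resid_of_walk {L : ℕ} [NeZero L] (hL : 2 ≤ L) {a b : Fin L}
    (v : (SimpleGraph.cycleGraph L).Walk a b) :
    ∃ z : ℤ, resid L z = a ∧ |z - (b : ℕ)| ≤ v.length := by
  induction v with
  | nil => exact ⟨_, resid_natCast_coe _, by simp⟩
  | cons h p ih =>
    obtain ⟨z, rfl, hz⟩ := ih
    obtain ⟨z', h1, h2⟩ := (cycleGraph_adj_resid_iff hL).1 h.symm
    refine ⟨z', h2, ?_⟩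
    refine (abs_sub_le z' z _).trans ?_
    rw [SimpleGraph.Walk.length_cons]
    push_cast
    linarith

/-- Going from `j` to `j + s` on the line gives a walk of length `s` on the ring. -/
lemma exists_walk_of_resid {L : ℕ} [NeZero L] (hL : 2 ≤ L) (j : ℤ) (s : ℕ) :
    ∃ v : (SimpleGraph.cycleGraph L).Walk (resid L j) (resid L (j + s)), v.length = s := by
  induction s with
  | zero => exact ⟨SimpleGraph.Walk.nil.copy rfl (by simp), by simp⟩
  | succ s ih =>
    obtain ⟨v, hv⟩ := ih
    have : (SimpleGraph.cycleGraph L).Adj (resid L (j + s)) (resid L (j + (s + 1 : ℕ))) :=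
      (cycleGraph_adj_resid_iff hL).2 ⟨j + (s + 1 : ℕ), by push_cast; simp, rfl⟩
    exact ⟨v.concat this, by simp [hv]⟩

/-- The site `⌊(L - 1) / 2⌋` is so central that the ring distance to it is the distance in `ℤ`. -/
lemma ringDist_midSite {L : ℕ} [NeZero L] (hL : 2 ≤ L) (k : Fin L) :
    ((ringDist k (midSite L) : ℕ) : ℤ) = |((k : ℕ) : ℤ) - ((L - 1) / 2 : ℕ)| := by
  have hm : ((midSite L : Fin L) : ℕ) = (L - 1) / 2 := by
    simp only [midSite, Fin.ofNat]
    exact Nat.mod_eq_of_lt (by omega)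
  have hk := k.isLt
  obtain ⟨p, hp⟩ : ∃ p : (SimpleGraph.cycleGraph L).Walk k (midSite L),
      (p.length : ℤ) = |((k : ℕ) : ℤ) - ((L - 1) / 2 : ℕ)| := by
    rcases le_total (k : ℕ) ((L - 1) / 2) with h | h
    · obtain ⟨v, hv⟩ := exists_walk_of_resid hL (k : ℕ) ((L - 1) / 2 - k)
      refine ⟨v.copy (resid_natCast_coe k) ?_, ?_⟩
      · rw [show ((k : ℕ) : ℤ) + (((L - 1) / 2 - k : ℕ) : ℤ) = (midSite L : ℕ) by omega,
          resid_natCast_coe]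
      · rw [SimpleGraph.Walk.length_copy, hv, abs_of_nonpos (by omega)]; omega
    · obtain ⟨v, hv⟩ := exists_walk_of_resid hL (((L - 1) / 2 : ℕ) : ℤ) (k - (L - 1) / 2)
      refine ⟨(v.copy ?_ ?_).reverse, ?_⟩
      · rw [← hm, resid_natCast_coe]
      · rw [show (((L - 1) / 2 : ℕ) : ℤ) + ((k - (L - 1) / 2 : ℕ) : ℤ) = (k : ℕ) by omega,
          resid_natCast_coe]
      · rw [SimpleGraph.Walk.length_reverse, SimpleGraph.Walk.length_copy, hv,
          abs_of_nonneg (by omega)]; omega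
  apply le_antisymm
  · rw [← hp]; exact_mod_cast SimpleGraph.dist_le p
  · obtain ⟨q, hq⟩ := (SimpleGraph.Walk.reachable p).exists_walk_length_eq_dist
    obtain ⟨z, hz, hzq⟩ := exists_resid_of_walk hL q
    rw [hq, hm] at hzq
    refine le_trans ?_ hzq
    by_cases h : z = (k : ℕ)
    · rw [h]
    · rw [← resid_natCast_coe k] at hz
      by_contra! hlt
      apply h
      apply eq_of_resid_eq hz <;> grind

/-- A sector of size at most `1 / 4` is the interval of the sites at integer distance less than
`θ L` from the site `⌊(L - 1) / 2⌋`. -/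
lemma mem_sector_iff {L : ℕ} [NeZero L] (hL : 2 ≤ L) {θ : ℝ} {k : Fin L} :
    k ∈ sector L θ ↔ ((|((k : ℕ) : ℤ) - ((L - 1) / 2 : ℕ)| : ℤ) : ℝ) < θ * L := by
  rw [sector, Finset.mem_filter, ← ringDist_midSite hL]
  simp

/-! ### Lifts of configurations to the integers -/

/-- The integers `Z 0 < Z 1 < … < Z (N - 1)` lie in a window of length `L`. The values `Z i` with
`N ≤ i` are irrelevant. -/
def IsWindow (L N : ℕ) (Z : ℕ → ℤ) : Prop :=
  ∀ i j, i < j → j < N → Z i < Z j ∧ Z j < Z i + L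

/-- The first `N` values of `Z` lift the particles of `x` from the ring to the line, in cyclic
order: they lie in a window of length `L` and their residues are the particles of `x`. -/
structure IsLift {L : ℕ} [NeZero L] {N : ℕ} (x : Config L N) (Z : ℕ → ℤ) : Prop where
  window : IsWindow L N Z
  mem : ∀ i < N, resid L (Z i) ∈ x.1

section Lift

variable {L N : ℕ} [NeZero L] {Z W : ℕ → ℤ} {x w : Config L N}

lemma IsWindow.eq_of_resid_eq (hZ : IsWindow L N Z) {i j : ℕ} (hi : i < N) (hj : j < N)
    (h : resid L (Z i) = resid L (Z j)) : i = j := by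
  have hL := Nat.pos_of_neZero L
  rcases lt_trichotomy i j with hij | hij | hij
  · have h1 := hZ i j hij hj
    have h2 := XXZRing.eq_of_resid_eq h (by omega) (by omega)
    omega
  · exact hij
  · have h1 := hZ j i hij hi
    have h2 := XXZRing.eq_of_resid_eq h (by omega) (by omega)
    omega

lemma IsWindow.card_image (hZ : IsWindow L N Z) :
    ((Finset.range N).image fun i => resid L (Z i)).card = N := by
  rw [Finset.card_image_of_injOn, Finset.card_range]
  intro _ hi _ hj h
  exact hZ.eq_of_resid_eq (by simpa using hi) (by simpa using hj) h

/-- The configuration whose particles are the residues of a window. -/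
def IsWindow.config (hZ : IsWindow L N Z) : Config L N :=
  ⟨(Finset.range N).image fun i => resid L (Z i), hZ.card_image⟩

lemma IsWindow.isLift_config (hZ : IsWindow L N Z) : IsLift hZ.config Z :=
  ⟨hZ, fun _ hi => Finset.mem_image_of_mem _ (Finset.mem_range.2 hi)⟩

lemma IsLift.image_eq (h : IsLift x Z) :
    ((Finset.range N).image fun i => resid L (Z i)) = x.1 := by
  apply Finset.eq_of_subset_of_card_le
  · intro a ha
    obtain ⟨i, hi, rfl⟩ := Finset.mem_image.1 ha
    exact h.mem i (Finset.mem_range.1 hi)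
  · rw [h.window.card_image, x.2]

lemma IsLift.mem_iff (h : IsLift x Z) {a : Fin L} : a ∈ x.1 ↔ ∃ i < N, resid L (Z i) = a := by
  rw [← h.image_eq]; simp

lemma IsLift.config_eq (hx : IsLift x Z) (hw : IsLift w W) (h : ∀ i < N, Z i = W i) : w = x := by
  apply Subtype.ext
  rw [← hx.image_eq, ← hw.image_eq]
  apply Finset.image_congr
  intro i hi
  simp only [h i (by simpa using hi)]

lemma isLift_particle (x : Config L N) :
    IsLift x fun i => if h : i < N then ((particle x ⟨i, h⟩ : ℕ) : ℤ) else 0 := by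
  constructor
  · intro i j hij hj
    have hlt : particle x ⟨i, hij.trans hj⟩ < particle x ⟨j, hj⟩ :=
      (x.1.orderEmbOfFin x.2).strictMono hij
    have := (particle x ⟨j, hj⟩).isLt
    simp only [hj, hij.trans hj, dite_true]
    omega
  · intro i hi
    simp only [hi, dite_true, resid_natCast_coe]
    exact Finset.orderEmbOfFin_mem _ _ _

lemma IsLift.sub_mul (h : IsLift x Z) (t : ℤ) : IsLift x fun i => Z i - t * L := by
  constructor
  · intro i j hij hj
    have := h.window i j hij hj
    simp only
    omega
  · intro i hi
    have := resid_add_mul (L := L) (Z i) (-t)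
    rw [neg_mul, ← sub_eq_add_neg] at this
    rw [this]
    exact h.mem i hi

/-! ### Walks of configurations and their lifts -/

/-- Moving one particle of a lift by one unit is a step in the graph of configurations. -/
lemma IsLift.adj_update (hL : 2 ≤ L) {x' : Config L N} {i : ℕ} {z : ℤ} (hi : i < N)
    (hz : |z - Z i| = 1) (hx : IsLift x Z) (hx' : IsLift x' (Function.update Z i z)) :
    (configGraph L N).Adj x x' := by
  refine ⟨resid L (Z i), resid L z, (cycleGraph_adj_resid_iff hL).2 ⟨z, hz, rfl⟩, ?_⟩
  have hzx : resid L z ∉ x.1 := by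
    intro h
    obtain ⟨j, hj, hjz⟩ := hx.mem_iff.1 h
    by_cases hij : j = i
    · subst hij
      have := eq_of_resid_eq hjz (by grind) (by grind)
      simp [this] at hz
    · exact hij (hx'.window.eq_of_resid_eq hj hi (by simpa [hij] using hjz))
  have hZx := hx.mem i hi
  have key : x'.1 = insert (resid L z) (x.1.erase (resid L (Z i))) := by
    apply Finset.eq_of_subset_of_card_le
    · intro a ha
      obtain ⟨j, hj, rfl⟩ := hx'.mem_iff.1 ha
      by_cases hij : j = i
      · subst hij; simp
      · have hne : resid L (Z j) ≠ resid L (Z i) :=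
          fun h => hij (hx.window.eq_of_resid_eq hj hi h)
        simp [hij, hne, hx.mem j hj]
    · rw [x'.2, Finset.card_insert_of_notMem (by simp [hzx]), Finset.card_erase_of_mem hZx, x.2]
      omega
  rw [key]
  ext a
  simp only [Finset.mem_symmDiff, Finset.mem_insert, Finset.mem_erase, Finset.mem_singleton]
  grind

/-- A step in the graph of configurations moves a single particle to an empty neighbouring site. -/
lemma exists_insert_erase_of_adj {L N : ℕ} {x x' : Config L N} (h : (configGraph L N).Adj x x') :
    ∃ p q, (SimpleGraph.cycleGraph L).Adj p q ∧ p ∈ x.1 ∧ q ∉ x.1 ∧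
      x'.1 = insert q (x.1.erase p) := by
  obtain ⟨a, b, hab, hs⟩ := h
  have hne := hab.ne
  have hmem : ∀ c, (c ∈ x.1 ∧ c ∉ x'.1 ∨ c ∈ x'.1 ∧ c ∉ x.1) ↔ c = a ∨ c = b := by
    intro c
    rw [← Finset.mem_symmDiff, hs]; simp
  have h1 : ¬ x.1 ⊆ x'.1 := by
    intro hsub
    have := Finset.eq_of_subset_of_card_le hsub (by rw [x.2, x'.2])
    have := (hmem a).2 (Or.inl rfl)
    grind
  have h2 : ¬ x'.1 ⊆ x.1 := by
    intro hsub
    have := Finset.eq_of_subset_of_card_le hsub (by rw [x.2, x'.2])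
    have := (hmem a).2 (Or.inl rfl)
    grind
  obtain ⟨p, hp, hp'⟩ := Finset.not_subset.1 h1
  obtain ⟨q, hq', hq⟩ := Finset.not_subset.1 h2
  refine ⟨p, q, ?_, hp, hq, ?_⟩
  · have := (hmem p).1 (Or.inl ⟨hp, hp'⟩)
    have := (hmem q).1 (Or.inr ⟨hq', hq⟩)
    have := hab.symm
    grind
  · ext c
    have := (hmem p).1 (Or.inl ⟨hp, hp'⟩)
    have := (hmem q).1 (Or.inr ⟨hq', hq⟩)
    have := hmem c
    simp only [Finset.mem_insert, Finset.mem_erase]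
    grind

/-- A step in the graph of configurations lifts to a move of one particle of any given lift. -/
lemma IsLift.exists_of_adj (hL : 2 ≤ L) {x' : Config L N} (hx : IsLift x Z)
    (h : (configGraph L N).Adj x x') :
    ∃ Z', IsLift x' Z' ∧ ∑ i ∈ Finset.range N, |Z' i - Z i| ≤ 1 := by
  obtain ⟨p, q, hpq, hp, hq, hx'⟩ := exists_insert_erase_of_adj h
  obtain ⟨i, hi, rfl⟩ := hx.mem_iff.1 hp
  obtain ⟨z, hz, rfl⟩ := (cycleGraph_adj_resid_iff hL).1 hpq
  have hne : ∀ j < N, ∀ t : ℤ, Z j ≠ z + t * L := by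
    intro j hj t hjt
    apply hq
    rw [← resid_add_mul z t, ← hjt]
    exact hx.mem j hj
  refine ⟨Function.update Z i z, ⟨?_, ?_⟩, ?_⟩
  · intro j k hjk hk
    have hw := hx.window j k hjk hk
    have a1 := hne j (hjk.trans hk) 0
    have a2 := hne k hk 0
    have a3 := hne j (hjk.trans hk) (-1)
    have a4 := hne k hk 1
    by_cases hj : j = i
    · subst hj
      have hkj : k ≠ j := by omega
      simp only [Function.update_self, Function.update_of_ne hkj]
      grind
    · by_cases hki : k = i
      · subst hki
        simp only [Function.update_self, Function.update_of_ne hj]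
        grind
      · simpa only [Function.update_of_ne hj, Function.update_of_ne hki] using hw
  · intro j hj
    by_cases hij : j = i
    · subst hij; simp [hx']
    · have hne : resid L (Z j) ≠ resid L (Z i) :=
        fun h => hij (hx.window.eq_of_resid_eq hj hi h)
      simp [hx', hij, hne, hx.mem j hj]
  · rw [Finset.sum_eq_single i]
    · simp [hz]
    · intro j _ hij; simp [hij]
    · simp [hi]

/-- A walk of configurations lifts to a motion of the particles on the line. This gives lower bounds
for the distance of configurations. -/
lemma IsLift.exists_of_walk (hL : 2 ≤ L) (v : (configGraph L N).Walk w x) (hw : IsLift w W) :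
    ∃ Z, IsLift x Z ∧ ∑ i ∈ Finset.range N, |Z i - W i| ≤ v.length := by
  induction v generalizing W with
  | nil => exact ⟨W, hw, by simp⟩
  | cons h p ih =>
    obtain ⟨U, hU, hUW⟩ := hw.exists_of_adj hL h
    obtain ⟨Z, hZ, hZU⟩ := ih hU
    refine ⟨Z, hZ, ?_⟩
    calc ∑ i ∈ Finset.range N, |Z i - W i|
        ≤ ∑ i ∈ Finset.range N, (|Z i - U i| + |U i - W i|) :=
          Finset.sum_le_sum fun i _ => abs_sub_le _ _ _
      _ ≤ _ := by
          rw [Finset.sum_add_distrib, SimpleGraph.Walk.length_cons]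
          push_cast
          exact add_le_add hZU hUW

/-- If the window `W` has room at its seam, then every other window `Z` has a particle that can move
one unit towards its target in `W`. -/
lemma IsWindow.exists_update {L N : ℕ} {Z W : ℕ → ℤ} (hZ : IsWindow L N Z)
    (hW : IsWindow L N W)
    (hgap : ∀ i < N, ∀ j < N, W i + 1 < W j + L) {i₀ : ℕ} (hi₀ : i₀ < N) (hne : Z i₀ ≠ W i₀) :
    ∃ i < N, ∃ z, |z - Z i| = 1 ∧ |Z i - W i| = |z - W i| + 1 ∧
      IsWindow L N (Function.update Z i z) := by
  rcases lt_or_gt_of_ne hne with hlt | hlt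
  · -- Among the particles farthest to the left of their targets, the rightmost one is free.
    obtain ⟨i, hi, hmax⟩ := Finset.exists_max_image (Finset.range N)
      (fun i => toLex (W i - Z i, i)) ⟨i₀, Finset.mem_range.2 hi₀⟩
    simp only [Finset.mem_range, Prod.Lex.le_iff, ofLex_toLex] at hi hmax
    have h0 := hmax i₀ hi₀
    refine ⟨i, hi, Z i + 1, by simp, by grind, ?_⟩
    intro j k hjk hk
    have h1 := hmax j (hjk.trans hk)
    have h2 := hmax k hk
    have hz := hZ j k hjk hk
    have hw := hW j k hjk hk
    have hg := hgap k hk j (hjk.trans hk)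
    by_cases hj : j = i
    · subst hj
      have hkj : k ≠ j := by omega
      simp only [Function.update_self, Function.update_of_ne hkj]
      omega
    · by_cases hki : k = i
      · subst hki
        simp only [Function.update_self, Function.update_of_ne hj]
        omega
      · simpa only [Function.update_of_ne hj, Function.update_of_ne hki] using hz
  · -- Among the particles farthest to the right of their targets, the leftmost one is free.
    obtain ⟨i, hi, hmax⟩ := Finset.exists_max_image (Finset.range N)
      (fun i => toLex (Z i - W i, -(i : ℤ))) ⟨i₀, Finset.mem_range.2 hi₀⟩
    simp only [Finset.mem_range, Prod.Lex.le_iff, ofLex_toLex] at hi hmax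
    have h0 := hmax i₀ hi₀
    refine ⟨i, hi, Z i - 1, by simp, by grind, ?_⟩
    intro j k hjk hk
    have h1 := hmax j (hjk.trans hk)
    have h2 := hmax k hk
    have hz := hZ j k hjk hk
    have hw := hW j k hjk hk
    have hg := hgap k hk j (hjk.trans hk)
    by_cases hj : j = i
    · subst hj
      have hkj : k ≠ j := by omega
      simp only [Function.update_self, Function.update_of_ne hkj]
      omega
    · by_cases hki : k = i
      · subst hki
        simp only [Function.update_self, Function.update_of_ne hj]
        omega
      · simpa only [Function.update_of_ne hj, Function.update_of_ne hki] using hz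

/-- If the lift `W` has room at its seam, then its configuration is joined to that of any lift `Z` by
a walk whose length is the total displacement of the particles. -/
lemma IsLift.exists_walk (hL : 2 ≤ L) (hw : IsLift w W)
    (hgap : ∀ i < N, ∀ j < N, W i + 1 < W j + L) (hx : IsLift x Z) :
    ∃ v : (configGraph L N).Walk w x,
      (v.length : ℤ) = ∑ i ∈ Finset.range N, |Z i - W i| := by
  obtain ⟨s, hs⟩ := Int.eq_ofNat_of_zero_le
    (Finset.sum_nonneg fun i (_ : i ∈ Finset.range N) => abs_nonneg (Z i - W i))
  induction s generalizing Z x with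
  | zero =>
    have h0 := (Finset.sum_eq_zero_iff_of_nonneg (fun _ _ => abs_nonneg _)).1 hs
    have : w = x := hx.config_eq hw fun i hi =>
      sub_eq_zero.1 (abs_eq_zero.1 (h0 i (Finset.mem_range.2 hi)))
    subst this
    exact ⟨SimpleGraph.Walk.nil, by rw [hs]; simp⟩
  | succ s ih =>
    obtain ⟨i₀, hi₀, hne⟩ : ∃ i₀ < N, Z i₀ ≠ W i₀ := by
      by_contra! h
      rw [Finset.sum_eq_zero fun i hi => by simp [h i (Finset.mem_range.1 hi)]] at hs
      push_cast at hs
      omega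
    obtain ⟨i, hi, z, hz, hzW, hwin⟩ := hx.window.exists_update hw.window hgap hi₀ hne
    have hsum : ∑ j ∈ Finset.range N, |Function.update Z i z j - W j| = (s : ℤ) := by
      have hmem := Finset.mem_range.2 hi
      rw [← Finset.add_sum_erase _ _ hmem] at hs ⊢
      rw [Finset.sum_congr rfl (g := fun j => |Z j - W j|)
        (fun j hj => by rw [Function.update_of_ne (Finset.ne_of_mem_erase hj)])]
      simp only [Function.update_self]
      push_cast at hs
      linarith
    obtain ⟨v, hv⟩ := ih hwin.isLift_config hsum
    refine ⟨v.concat (hx.adj_update hL hi hz hwin.isLift_config).symm, ?_⟩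
    rw [SimpleGraph.Walk.length_concat, hs]
    push_cast
    rw [hv, hsum]

end Lift

/-! ### Droplets and the distance to them -/

section Droplet

variable {L N : ℕ} [NeZero L] {Z : ℕ → ℤ} {x : Config L N}

lemma droplet_resid (hN : 0 < N) (c : ℤ) :
    droplet L N (resid L c) =
      (Finset.range N).image fun i : ℕ => resid L (c - ((N : ℤ) - 1) / 2 + i) := by
  have hc : ((resid L c : ℕ) : ℤ) = c + (-(c / L)) * L := by
    rw [coe_resid]
    have := Int.emod_add_mul_ediv c L
    linear_combination this
  ext a
  simp only [droplet, Finset.mem_image, Finset.mem_Icc, Finset.mem_range]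
  constructor
  · rintro ⟨z, ⟨h1, h2⟩, rfl⟩
    refine ⟨(z - ((resid L c : ℕ) - ((N : ℤ) - 1) / 2)).toNat, by omega, ?_⟩
    rw [← resid_add_mul _ (-(c / L))]
    congr 1
    have : ((z - ((resid L c : ℕ) - ((N : ℤ) - 1) / 2)).toNat : ℤ) =
      z - ((resid L c : ℕ) - ((N : ℤ) - 1) / 2) := by omega
    rw [this]
    linarith
  · rintro ⟨i, hi, rfl⟩
    refine ⟨(resid L c : ℕ) - ((N : ℤ) - 1) / 2 + i, by omega, ?_⟩
    rw [← resid_add_mul (c - _ + _) (-(c / L)), hc]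
    congr 1
    ring

/-- The droplet of the sites `m, …, m + N - 1` is lifted by `i ↦ m + i`. -/
lemma exists_isLift_droplet (hN : 0 < N) (hNL : N < L) (m : ℤ) :
    ∃ c : Config L N, c.1 = droplet L N (resid L (m + ((N : ℤ) - 1) / 2)) ∧
      IsLift c fun i => m + i := by
  have hw : IsWindow L N fun i => m + i := by
    intro i j hij hj
    simp only
    omega
  exact ⟨hw.config, by simp [droplet_resid hN, IsWindow.config], hw.isLift_config⟩

lemma exists_walk_droplet (hN : 0 < N) (hNL : N < L) (m : ℤ) (hx : IsLift x Z) :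
    ∃ c : Config L N, c.1 = droplet L N (resid L (m + ((N : ℤ) - 1) / 2)) ∧
      ∃ v : (configGraph L N).Walk c x,
        (v.length : ℤ) = ∑ i ∈ Finset.range N, |Z i - (m + i)| := by
  obtain ⟨c, hc, hcl⟩ := exists_isLift_droplet hN hNL m
  refine ⟨c, hc, hcl.exists_walk (by omega) ?_ hx⟩
  intro i hi j hj
  omega

lemma distToDroplets_le_configDist {c : Config L N} {m : Fin L} (hc : c.1 = droplet L N m) :
    distToDroplets x ≤ configDist x c :=
  Nat.sInf_le ⟨c, ⟨m, hc⟩, rfl⟩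

lemma distToDroplets_le_sum (hN : 0 < N) (hNL : N < L) (m : ℤ) (hx : IsLift x Z) :
    (distToDroplets x : ℤ) ≤ ∑ i ∈ Finset.range N, |Z i - (m + i)| := by
  obtain ⟨c, hc, v, hv⟩ := exists_walk_droplet hN hNL m hx
  rw [← hv, Nat.cast_le]
  refine (distToDroplets_le_configDist hc).trans ?_
  rw [configDist, SimpleGraph.dist_comm]
  exact SimpleGraph.dist_le v

/-- The distance to the droplets is attained by a lift of the configuration and an interval of
length `N`. -/
lemma exists_isLift_sum_le_distToDroplets (hN : 0 < N) (hNL : N < L) (x : Config L N) :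
    ∃ Z m, IsLift x Z ∧
      ∑ i ∈ Finset.range N, |Z i - (m + i)| ≤ (distToDroplets x : ℤ) := by
  have hne : ((fun c => configDist x c) '' dropletConfigs L N).Nonempty := by
    obtain ⟨c, hc, -⟩ := exists_isLift_droplet hN hNL 0
    exact ⟨_, c, ⟨_, hc⟩, rfl⟩
  obtain ⟨c, ⟨m, hm⟩, hcx⟩ := Nat.sInf_mem hne
  obtain ⟨c', hc', v, -⟩ :=
    exists_walk_droplet hN hNL ((m : ℕ) - ((N : ℤ) - 1) / 2) (isLift_particle x)
  obtain ⟨c'', hc'', hl⟩ := exists_isLift_droplet hN hNL ((m : ℕ) - ((N : ℤ) - 1) / 2)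
  rw [sub_add_cancel, resid_natCast_coe, ← hm] at hc' hc''
  obtain rfl := Subtype.ext hc'
  obtain rfl := Subtype.ext hc''
  obtain ⟨p, hp⟩ := v.reachable.exists_walk_length_eq_dist
  obtain ⟨Z, hZ, hsum⟩ := hl.exists_of_walk (by omega) p
  refine ⟨Z, _, hZ, hsum.trans ?_⟩
  rw [hp, Nat.cast_le, distToDroplets, ← hcx, SimpleGraph.dist_comm]
  exact le_rfl

/-! ### Optimal lifts do not cut the interval -/

/-- Moving the last particle by `-L` to the front gives another lift. -/
lemma IsLift.rotate_right (hN : 0 < N) (hx : IsLift x Z) :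
    IsLift x fun i => if i = 0 then Z (N - 1) - L else Z (i - 1) := by
  constructor
  · intro i j hij hj
    have hj0 : j ≠ 0 := by omega
    simp only [hj0, if_false]
    split_ifs with hi
    · have h1 : Z (N - 1) - L < Z (j - 1) := by
        have := hx.window (j - 1) (N - 1) (by omega) (by omega)
        omega
      have h2 : Z (j - 1) < Z (N - 1) := (hx.window (j - 1) (N - 1) (by omega) (by omega)).1
      omega
    · exact hx.window (i - 1) (j - 1) (by omega) (by omega)
  · intro i hi
    split_ifs
    · rw [resid_sub_self]; exact hx.mem _ (by omega)
    · exact hx.mem _ (by omega)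

/-- Moving the first particle by `L` to the back gives another lift. -/
lemma IsLift.rotate_left (hN : 0 < N) (hx : IsLift x Z) :
    IsLift x fun i => if i + 1 = N then Z 0 + L else Z (i + 1) := by
  constructor
  · intro i j hij hj
    have hi : i + 1 ≠ N := by omega
    simp only [hi, if_false]
    split_ifs with hj'
    · have := hx.window 0 (i + 1) (by omega) (by omega)
      omega
    · exact hx.window (i + 1) (j + 1) (by omega) (by omega)
  · intro i hi
    split_ifs
    · rw [resid_add_self]; exact hx.mem _ (by omega)
    · exact hx.mem _ (by omega)

lemma sum_rotate_right {N : ℕ} (hN : 0 < N) (a : ℤ) (Z : ℕ → ℤ) (m : ℤ) :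
    ∑ i ∈ Finset.range N, |(if i = 0 then Z (N - 1) - a else Z (i - 1)) - (m - 1 + i)| +
        |Z (N - 1) - (m + (N - 1))| =
      ∑ i ∈ Finset.range N, |Z i - (m + i)| + |Z (N - 1) - a - (m - 1)| := by
  obtain ⟨k, rfl⟩ := Nat.exists_eq_succ_of_ne_zero hN.ne'
  rw [Nat.succ_eq_add_one, Finset.sum_range_succ', Finset.sum_range_succ (fun i => |Z i - _|)]
  simp only [Nat.add_eq_zero_iff, one_ne_zero, and_false, if_false, Nat.add_sub_cancel, if_true]
  push_cast
  have h : ∀ i : ℕ, Z i - (m - 1 + (i + 1)) = Z i - (m + i) := fun i => by ring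
  simp only [h, add_zero, add_sub_cancel_right]
  ring

lemma sum_rotate_left {N : ℕ} (hN : 0 < N) (a : ℤ) (Z : ℕ → ℤ) (m : ℤ) :
    ∑ i ∈ Finset.range N, |(if i + 1 = N then Z 0 + a else Z (i + 1)) - (m + 1 + i)| +
        |Z 0 - m| =
      ∑ i ∈ Finset.range N, |Z i - (m + i)| + |Z 0 + a - (m + N)| := by
  obtain ⟨k, rfl⟩ := Nat.exists_eq_succ_of_ne_zero hN.ne'
  rw [Nat.succ_eq_add_one, Finset.sum_range_succ, Finset.sum_range_succ' (fun i => |Z i - _|)]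
  rw [Finset.sum_congr rfl (g := fun i => |Z (i + 1) - (m + ((i + 1 : ℕ) : ℤ))|)]
  · have h : Z 0 + a - (m + 1 + k) = Z 0 + a - (m + (k + 1)) := by ring
    simp only [if_true]
    push_cast
    rw [h, add_zero]
    ring
  · intro i hi
    have : i + 1 ≠ k + 1 := by have := Finset.mem_range.1 hi; omega
    simp only [this, if_false]
    push_cast
    ring_nf

lemma resid_mem_iff_of_mem_Ioo {Γ : Finset (Fin L)} {A B z : ℤ} (hA : 0 ≤ A) (hB : B < L) (hAB : A ≤ B)
    (hΓ : ∀ k : Fin L, k ∈ Γ ↔ A ≤ (k : ℕ) ∧ ((k : ℕ) : ℤ) ≤ B)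
    (h1 : B - L < z) (h2 : z < A + L) : resid L z ∈ Γ ↔ A ≤ z ∧ z ≤ B := by
  rw [hΓ]
  by_cases hz : z < 0
  · rw [← resid_add_self]
    rw [coe_resid_of_mem (by omega) (by omega)]
    omega
  · by_cases hzL : z < L
    · rw [coe_resid_of_mem (by omega) hzL]
    · rw [← resid_sub_self, coe_resid_of_mem (by omega) (by omega)]
      omega

lemma IsLift.inter_eq_image (hx : IsLift x Z) (Γ : Finset (Fin L)) :
    x.1 ∩ Γ = ((Finset.range N).filter fun i => resid L (Z i) ∈ Γ).image
      fun i => resid L (Z i) := by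
  ext a
  simp only [Finset.mem_inter, hx.mem_iff, Finset.mem_image, Finset.mem_filter, Finset.mem_range]
  grind

lemma IsLift.card_inter (hx : IsLift x Z) (Γ : Finset (Fin L)) :
    (x.1 ∩ Γ).card = ((Finset.range N).filter fun i => resid L (Z i) ∈ Γ).card := by
  rw [hx.inter_eq_image, Finset.card_image_of_injOn]
  intro i hi j hj h
  simp only [Finset.mem_coe, Finset.mem_filter, Finset.mem_range] at hi hj
  exact hx.window.eq_of_resid_eq hi.1 hj.1 h

/-- Suppose that the lift `Z` of `x` and the interval `m, …, m + N - 1` realise the distance of `x`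
to the droplets, and that this distance is so small that the particles in the short interval `Γ`
cannot all be at distance `L / 4` from their targets. Then `Z` does not cut `Γ`: the particles in `Γ`
are lifted to the same copy of it. Otherwise the first particle lies in `Γ` and the last one in the
next copy of `Γ`, and the sum gets smaller if the one farther from its target is moved to the other
end. -/
lemma IsLift.mem_Icc_of_minimal {Γ : Finset (Fin L)} {A B m : ℤ} (hx : IsLift x Z) (hN : 0 < N)
    (hA : 0 ≤ A) (hB : B < L) (hΓ : ∀ k : Fin L, k ∈ Γ ↔ A ≤ (k : ℕ) ∧ ((k : ℕ) : ℤ) ≤ B)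
    (hAB : 8 * (B - A) < L) (hNL : 16 * N ≤ L)
    (hmin : ∀ Z' m', IsLift x Z' →
      ∑ i ∈ Finset.range N, |Z i - (m + i)| ≤ ∑ i ∈ Finset.range N, |Z' i - (m' + i)|)
    (hsum : 4 * ∑ i ∈ Finset.range N, |Z i - (m + i)| < (x.1 ∩ Γ).card * L)
    (h0 : B - L < Z 0) (h0' : Z 0 ≤ B) {i : ℕ} (hi : i < N) (hiΓ : resid L (Z i) ∈ Γ) :
    A ≤ Z i ∧ Z i ≤ B := by
  have hAB' : A ≤ B := ((hΓ _).1 hiΓ).1.trans ((hΓ _).1 hiΓ).2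
  have hle : ∀ j < N, Z 0 ≤ Z j ∧ Z j < Z 0 + L := by
    intro j hj
    rcases Nat.eq_zero_or_pos j with rfl | hj0
    · omega
    · have := hx.window 0 j hj0 hj
      omega
  have hle' : ∀ j < N, Z j ≤ Z (N - 1) := by
    intro j hj
    rcases eq_or_lt_of_le (Nat.le_sub_one_of_lt hj) with rfl | hj0
    · exact le_rfl
    · exact (hx.window j (N - 1) hj0 (by omega)).1.le
  by_cases hiA : Z i < A + L
  · exact (resid_mem_iff_of_mem_Ioo hA hB hAB' hΓ (by have := hle i hi; omega) hiA).1 hiΓ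
  exfalso
  have hi1 := hle i hi
  have hi2 := hle' i hi
  have hl := hle (N - 1) (by omega)
  -- The interval starts before `B + L / 4`: the last particle is better off at the front.
  by_cases hm1 : 4 * m ≤ 4 * B + L
  · have h1 := hmin _ (m - 1) (hx.rotate_right hN)
    have h2 := sum_rotate_right hN L Z m
    grind
  -- The interval ends after `A + 3 L / 4`: the first particle is better off at the back.
  by_cases hm2 : 4 * A + 3 * L ≤ 4 * m + 4 * N
  · have h1 := hmin _ (m + 1) (hx.rotate_left hN)
    have h2 := sum_rotate_left hN L Z m
    grind
  -- Otherwise all particles in `Γ` are at distance at least `L / 4` from their targets.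
  rw [hx.card_inter, Finset.mul_sum] at hsum
  refine absurd hsum (not_lt.2 ?_)
  rw [← nsmul_eq_mul, ← Finset.sum_const]
  refine le_trans (Finset.sum_le_sum fun j hj => ?_)
    (Finset.sum_le_sum_of_subset_of_nonneg (Finset.filter_subset _ _)
      fun j _ _ => by positivity)
  simp only [Finset.mem_filter, Finset.mem_range] at hj
  have hj1 := hle j hj.1
  by_cases hjA : Z j < A + L
  · have := (resid_mem_iff_of_mem_Ioo hA hB hAB' hΓ (by omega) hjA).1 hj.2
    have := neg_abs_le (Z j - (m + j))
    omega
  · have := le_abs_self (Z j - (m + j))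
    omega

end Droplet

/-! ### Windows split by an interval -/

section Split

lemma IsWindow.sub_le_sub {L N : ℕ} {Z : ℕ → ℤ} (hZ : IsWindow L N Z) {i j : ℕ} (hij : i ≤ j)
    (hj : j < N) : (j : ℤ) - i ≤ Z j - Z i := by
  induction j, hij using Nat.le_induction with
  | base => simp
  | succ k hk ih =>
    have := ih (by omega)
    have := (hZ k (k + 1) (by omega) hj).1
    push_cast
    omega

lemma IsWindow.exists_lt_iff {L N : ℕ} {Z : ℕ → ℤ} (hZ : IsWindow L N Z) (c : ℤ) :
    ∃ ℓ ≤ N, ∀ i < N, Z i < c ↔ i < ℓ := by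
  classical
  have hex : ∃ i, N ≤ i ∨ c ≤ Z i := ⟨N, Or.inl le_rfl⟩
  refine ⟨Nat.find hex, Nat.find_min' hex (Or.inl le_rfl), fun i hi => ?_⟩
  rw [Nat.lt_find_iff]
  constructor
  · intro h j hj
    have := hZ.sub_le_sub hj hi
    omega
  · intro h
    have := h i le_rfl
    omega

/-- Of the integers `Z 0 < Z 1 < … < Z (ℓ + n + r - 1)`, the first `ℓ` are smaller than `A`, the
last `r` are larger than `B`, and the `n` in the middle lie between `A` and `B`. -/
structure IsSplit (Z : ℕ → ℤ) (A B : ℤ) (ℓ n r : ℕ) : Prop where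
  left : ∀ i < ℓ, Z i < A
  mid : ∀ i, ℓ ≤ i → i < ℓ + n → A ≤ Z i ∧ Z i ≤ B
  right : ∀ i, ℓ + n ≤ i → i < ℓ + n + r → B < Z i

lemma IsSplit.mid_iff {Z : ℕ → ℤ} {A B : ℤ} {ℓ n r : ℕ} (h : IsSplit Z A B ℓ n r) {i : ℕ}
    (hi : i < ℓ + n + r) : (A ≤ Z i ∧ Z i ≤ B) ↔ ℓ ≤ i ∧ i < ℓ + n := by
  constructor
  · rintro ⟨h1, h2⟩
    constructor
    · by_contra! h3
      have := h.left i h3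
      omega
    · by_contra! h3
      have := h.right i h3 hi
      omega
  · rintro ⟨h1, h2⟩
    exact h.mid i h1 h2

lemma IsWindow.exists_isSplit {L N : ℕ} {Z : ℕ → ℤ} (hZ : IsWindow L N Z) {A B : ℤ} (hAB : A ≤ B)
    {n : ℕ} (hn : ((Finset.range N).filter fun i => A ≤ Z i ∧ Z i ≤ B).card = n) :
    ∃ ℓ r, ℓ + n + r = N ∧ IsSplit Z A B ℓ n r := by
  obtain ⟨ℓ, hℓ, h1⟩ := hZ.exists_lt_iff A
  obtain ⟨h, hh, h2⟩ := hZ.exists_lt_iff (B + 1)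
  have hset : ((Finset.range N).filter fun i => A ≤ Z i ∧ Z i ≤ B) = Finset.Ico ℓ h := by
    ext i
    simp only [Finset.mem_filter, Finset.mem_range, Finset.mem_Ico]
    constructor
    · rintro ⟨hi, h3, h4⟩
      have := h1 i hi
      have := h2 i hi
      omega
    · rintro ⟨h3, h4⟩
      have := h1 i (by omega)
      have := h2 i (by omega)
      omega
  rw [hset, Nat.card_Ico] at hn
  have hℓh : ℓ ≤ h := by
    by_contra! hlt
    have := h1 h (by omega)
    have := h2 h (by omega)
    omega
  refine ⟨ℓ, N - h, by omega, ?_, ?_, ?_⟩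
  · intro i hi
    exact (h1 i (by omega)).2 hi
  · intro i h3 h4
    have := h1 i (by omega)
    have := h2 i (by omega)
    omega
  · intro i h3 h4
    have := h2 i (by omega)
    omega

/-- The lift of `y ∪ b_{ℓ,r}`: the particles outside `[A, B]` are moved next to the interval. -/
def boundaryLift (Z : ℕ → ℤ) (A B : ℤ) (ℓ n : ℕ) (i : ℕ) : ℤ :=
  if i < ℓ then A - ℓ + i else if i < ℓ + n then Z i else B + 1 + (i - ℓ - n)

variable {L : ℕ} {Z : ℕ → ℤ} {A B : ℤ} {ℓ n r : ℕ}

lemma IsSplit.boundaryLift_mem (h : IsSplit Z A B ℓ n r) (hAB : A ≤ B) {i : ℕ}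
    (hi : i < ℓ + n + r) :
    A - ℓ ≤ boundaryLift Z A B ℓ n i ∧ boundaryLift Z A B ℓ n i ≤ B + r := by
  rw [boundaryLift]
  split_ifs with h1 h2
  · omega
  · have := h.mid i (by omega) h2
    omega
  · omega

lemma IsSplit.isWindow_boundaryLift (h : IsSplit Z A B ℓ n r) (hZ : IsWindow L (ℓ + n + r) Z)
    (hAB : A ≤ B) (hL : B - A + ℓ + r + 1 < L) :
    IsWindow L (ℓ + n + r) (boundaryLift Z A B ℓ n) := by
  intro i j hij hj
  have hi' := h.boundaryLift_mem hAB (hij.trans hj)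
  have hj' := h.boundaryLift_mem hAB hj
  refine ⟨?_, by omega⟩
  have := (hZ i j hij hj).1
  rw [boundaryLift, boundaryLift]
  split_ifs with h1 h2 h3 h4 h5 h6
  · omega
  · have := h.mid j (by omega) h3; omega
  · omega
  · omega
  · omega
  · have := h.mid i (by omega) h4; omega
  · omega
  · omega
  · omega

/-- The boundary lift is at the same time between the given lift and the interval of sites around
any particle `p` inside `[A, B]`. -/
lemma IsSplit.sum_abs_add_sum_abs (h : IsSplit Z A B ℓ n r) (hZ : IsWindow L (ℓ + n + r) Z) {p : ℕ}
    (hp : ℓ ≤ p) (hp' : p < ℓ + n) :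
    ∑ i ∈ Finset.range (ℓ + n + r), |boundaryLift Z A B ℓ n i - (Z p - p + i)| +
        ∑ i ∈ Finset.range (ℓ + n + r), |Z i - boundaryLift Z A B ℓ n i| =
      ∑ i ∈ Finset.range (ℓ + n + r), |Z i - (Z p - p + i)| := by
  rw [← Finset.sum_add_distrib]
  refine Finset.sum_congr rfl fun i hi => ?_
  rw [Finset.mem_range] at hi
  rw [boundaryLift]
  have hpm := h.mid p hp hp'
  split_ifs with h1 h2
  · have e1 := hZ.sub_le_sub (i := i) (j := ℓ) h1.le (by omega)
    have e2 := hZ.sub_le_sub (i := ℓ) (j := p) hp (by omega)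
    have e3 := hZ.sub_le_sub (i := i) (j := ℓ - 1) (by omega) (by omega)
    have e4 := h.left (ℓ - 1) (by omega)
    have e5 := h.mid ℓ le_rfl (by omega)
    have e6 : ((ℓ - 1 : ℕ) : ℤ) = ℓ - 1 := by omega
    rw [abs_of_nonpos (by omega), abs_of_nonpos (by omega), abs_of_nonpos (by omega)]
    ring
  · simp
  · have e2 := hZ.sub_le_sub (i := p) (j := ℓ + n - 1) (by omega) (by omega)
    have e3 := hZ.sub_le_sub (i := ℓ + n) (j := i) (by omega) (by omega)
    have e4 := h.right (ℓ + n) (by omega) (by omega)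
    have e5 := h.mid (ℓ + n - 1) (by omega) (by omega)
    have e6 : ((ℓ + n - 1 : ℕ) : ℤ) = ℓ + n - 1 := by omega
    rw [abs_of_nonneg (by omega), abs_of_nonneg (by omega), abs_of_nonneg (by omega)]
    ring

/-- Of all intervals of `N` integers, the one aligned with the middle particle of a window is closest
to the window. -/
lemma IsWindow.sum_abs_median_le {N : ℕ} (hZ : IsWindow L N Z) (m : ℤ) :
    ∑ i ∈ Finset.range N, |Z i - (Z ((N - 1) / 2) - ((N - 1) / 2 : ℕ) + i)| ≤
      ∑ i ∈ Finset.range N, |Z i - (m + i)| := by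
  set p := (N - 1) / 2 with hp
  -- Pair each particle with its mirror image in the order.
  have key : ∀ f : ℕ → ℤ, 2 * ∑ i ∈ Finset.range N, f i =
      ∑ i ∈ Finset.range N, (f i + f (N - 1 - i)) := by
    intro f
    rw [Finset.sum_add_distrib, Finset.sum_range_reflect]
    ring
  refine le_of_mul_le_mul_left ?_ (zero_lt_two' ℤ)
  rw [key, key]
  refine Finset.sum_le_sum fun i hi => ?_
  rw [Finset.mem_range] at hi
  -- The middle particle separates the `i`-th particle from the `i`-th to last one.
  rcases le_or_gt i p with h | h
  · have e1 := hZ.sub_le_sub (i := i) (j := p) h (by omega)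
    have e2 := hZ.sub_le_sub (i := p) (j := N - 1 - i) (by omega) (by omega)
    rw [abs_of_nonpos (a := Z i - _) (by omega), abs_of_nonneg (a := Z (N - 1 - i) - _) (by omega)]
    have := neg_abs_le (Z i - (m + i))
    have := le_abs_self (Z (N - 1 - i) - (m + (N - 1 - i : ℕ)))
    omega
  · have e1 := hZ.sub_le_sub (i := N - 1 - i) (j := p) (by omega) (by omega)
    have e2 := hZ.sub_le_sub (i := p) (j := i) (by omega) (by omega)
    rw [abs_of_nonneg (a := Z i - (Z p - _ + _)) (by omega),
      abs_of_nonpos (a := Z (N - 1 - i) - (Z p - _ + _)) (by omega)]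
    have := neg_abs_le (Z (N - 1 - i) - (m + (N - 1 - i : ℕ)))
    have := le_abs_self (Z i - (m + i))
    omega

/-- The displacements of the particles left and right of `[A, B]` add up to the distance from the
boundary lift. -/
lemma IsSplit.sum_abs_sub_boundaryLift (h : IsSplit Z A B ℓ n r)
    (hZ : IsWindow L (ℓ + n + r) Z) :
    ∑ i ∈ Finset.range (ℓ + n + r), |Z i - boundaryLift Z A B ℓ n i| =
      ((∑ j : Fin ℓ, (A - (j + 1) - Z (ℓ - 1 - j)).toNat : ℕ) : ℤ) +
        ((∑ j : Fin r, (Z (ℓ + n + j) - (B + (j + 1))).toNat : ℕ) : ℤ) := by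
  rw [Finset.sum_range_add, Finset.sum_range_add, Fin.sum_univ_eq_sum_range
    (fun j => (A - (j + 1) - Z (ℓ - 1 - j)).toNat), Fin.sum_univ_eq_sum_range
    (fun j => (Z (ℓ + n + j) - (B + (j + 1))).toNat), ← Finset.sum_range_reflect _ ℓ]
  push_cast
  have hmid : ∑ i ∈ Finset.range n, |Z (ℓ + i) - boundaryLift Z A B ℓ n (ℓ + i)| = 0 := by
    refine Finset.sum_eq_zero fun i hi => ?_
    rw [Finset.mem_range] at hi
    simp [boundaryLift, hi]
  rw [hmid, add_zero]
  congr 1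
  · refine Finset.sum_congr rfl fun i hi => ?_
    rw [Finset.mem_range] at hi
    have e3 := hZ.sub_le_sub (i := ℓ - 1 - i) (j := ℓ - 1) (by omega) (by omega)
    have e4 := h.left (ℓ - 1) (by omega)
    rw [boundaryLift, if_pos (by omega), abs_of_nonpos (by omega)]
    omega
  · refine Finset.sum_congr rfl fun i hi => ?_
    rw [Finset.mem_range] at hi
    have e3 := hZ.sub_le_sub (i := ℓ + n) (j := ℓ + n + i) (by omega) (by omega)
    have e4 := h.right (ℓ + n) (by omega) (by omega)
    rw [boundaryLift, if_neg (by omega), if_neg (by omega), abs_of_nonneg (by omega)]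
    omega

variable [NeZero L] {x : Config L (ℓ + n + r)} {Γ : Finset (Fin L)}

lemma IsSplit.inter_eq_image (h : IsSplit Z A B ℓ n r) (hx : IsLift x Z)
    (hΓ : ∀ i < ℓ + n + r, resid L (Z i) ∈ Γ ↔ A ≤ Z i ∧ Z i ≤ B) :
    x.1 ∩ Γ = (Finset.Ico ℓ (ℓ + n)).image fun i => resid L (Z i) := by
  rw [hx.inter_eq_image]
  congr 1
  ext i
  simp only [Finset.mem_filter, Finset.mem_range, Finset.mem_Ico]
  constructor
  · rintro ⟨h1, h2⟩
    exact (h.mid_iff h1).1 ((hΓ i h1).1 h2)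
  · rintro ⟨h1, h2⟩
    have h3 : i < ℓ + n + r := by omega
    exact ⟨h3, (hΓ i h3).2 (h.mid i h1 h2)⟩

lemma IsSplit.orderEmbOfFin_inter (h : IsSplit Z A B ℓ n r) (hx : IsLift x Z)
    (hA : 0 ≤ A) (hB : B < L)
    (hΓ : ∀ i < ℓ + n + r, resid L (Z i) ∈ Γ ↔ A ≤ Z i ∧ Z i ≤ B)
    (hy : (x.1 ∩ Γ).card = n) (i : Fin n) :
    (x.1 ∩ Γ).orderEmbOfFin hy i = resid L (Z (ℓ + i)) := by
  have hf : ∀ j : Fin n, ((resid L (Z (ℓ + j)) : ℕ) : ℤ) = Z (ℓ + j) := by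
    intro j
    have := h.mid (ℓ + j) (by omega) (by omega)
    exact coe_resid_of_mem (by omega) (by omega)
  rw [← Finset.orderEmbOfFin_unique hy (f := fun j : Fin n => resid L (Z (ℓ + j)))]
  · intro j
    rw [h.inter_eq_image hx hΓ]
    exact Finset.mem_image_of_mem _ (by simp)
  · intro j k hjk
    have h1 := (hx.window (ℓ + j) (ℓ + k) (by simpa using hjk) (by omega)).1
    have h2 := hf j
    have h3 := hf k
    rw [Fin.lt_def]
    simp only
    omega

lemma IsSplit.image_boundaryLift (h : IsSplit Z A B ℓ n r) (hx : IsLift x Z)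
    (hΓ : ∀ i < ℓ + n + r, resid L (Z i) ∈ Γ ↔ A ≤ Z i ∧ Z i ≤ B)
    (hl : (leftEnd Γ : ℤ) = A) (hr : (rightEnd Γ : ℤ) = B) :
    ((Finset.range (ℓ + n + r)).image fun i => resid L (boundaryLift Z A B ℓ n i)) =
      x.1 ∩ Γ ∪ boundaryConfig Γ ℓ r := by
  rw [h.inter_eq_image hx hΓ, boundaryConfig, hl, hr]
  ext a
  simp only [Finset.mem_image, Finset.mem_range, Finset.mem_union, Finset.mem_Ico, Finset.mem_Icc]
  constructor
  · rintro ⟨i, hi, rfl⟩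
    rw [boundaryLift]
    split_ifs with h1 h2
    · exact Or.inr (Or.inl ⟨ℓ - i, by omega, by congr 1; omega⟩)
    · exact Or.inl ⟨i, by omega, rfl⟩
    · exact Or.inr (Or.inr ⟨i + 1 - ℓ - n, by omega, by congr 1; omega⟩)
  · rintro (⟨i, hi, rfl⟩ | ⟨j, hj, rfl⟩ | ⟨j, hj, rfl⟩)
    · exact ⟨i, by omega, by rw [boundaryLift, if_neg (by omega), if_pos (by omega)]⟩
    · refine ⟨ℓ - j, by omega, ?_⟩
      rw [boundaryLift, if_pos (by omega)]
      congr 1; omega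
    · refine ⟨ℓ + n + j - 1, by omega, ?_⟩
      rw [boundaryLift, if_neg (by omega), if_neg (by omega)]
      congr 1; omega

end Split

/-! ### Labels and displacements -/

lemma coe_finRotate_pow {N : ℕ} (h : ℕ) (i : Fin N) :
    (((finRotate N ^ h) i : Fin N) : ℕ) = (i + h) % N := by
  induction h with
  | zero => simp [Nat.mod_eq_of_lt i.isLt]
  | succ h ih =>
    obtain ⟨M, rfl⟩ := Nat.exists_eq_succ_of_ne_zero (Nat.pos_iff_ne_zero.1 i.pos)
    rw [pow_succ', Equiv.Perm.mul_apply, finRotate_apply, Fin.val_add, ih, Fin.val_one',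
      ← Nat.add_mod, add_assoc]

/-- A lift labels the particles in their natural order up to a cyclic shift. -/
lemma IsLift.exists_zpowers_finRotate {L N : ℕ} [NeZero L] {x : Config L N} {Z : ℕ → ℤ}
    (hx : IsLift x Z) :
    ∃ σ ∈ Subgroup.zpowers (finRotate N), ∀ j : Fin N, particle x (σ j) = resid L (Z j) := by
  have hL : (0 : ℤ) < L := by exact_mod_cast Nat.pos_of_neZero L
  -- The particles of this translate lie in `[0, L)`, up to the `h`-th one, or in `[L, 2 L)`.
  set Y : ℕ → ℤ := fun i => Z i - Z 0 / L * L with hY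
  have hYx : IsLift x Y := hx.sub_mul _
  have hYZ : ∀ i, resid L (Y i) = resid L (Z i) := by
    intro i
    have := resid_add_mul (L := L) (Z i) (-(Z 0 / L))
    rwa [neg_mul, ← sub_eq_add_neg] at this
  have hY0 : 0 ≤ Y 0 ∧ Y 0 < L := by
    have h1 := Int.emod_add_mul_ediv (Z 0) L
    have h2 := Int.emod_nonneg (Z 0) hL.ne'
    have h3 := Int.emod_lt_of_pos (Z 0) hL
    have h4 : Y 0 = Z 0 % L := by rw [hY]; linear_combination -h1
    omega
  clear_value Y
  have hle : ∀ j < N, Y 0 ≤ Y j ∧ Y j < Y 0 + L := by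
    intro j hj
    rcases Nat.eq_zero_or_pos j with rfl | hj0
    · omega
    · have := hYx.window 0 j hj0 hj
      omega
  obtain ⟨h, hh, hlt⟩ := hYx.window.exists_lt_iff L
  have hf : ∀ i : Fin N, particle x i = resid L (Y ((i + h) % N)) := by
    have hval : ∀ i : Fin N, ((i : ℕ) + h < N ∧ ((i : ℕ) + h) % N = i + h ∧
          ((resid L (Y ((i + h) % N)) : ℕ) : ℤ) = Y (i + h) - L) ∨
        (N ≤ (i : ℕ) + h ∧ ((i : ℕ) + h) % N = i + h - N ∧
          ((resid L (Y ((i + h) % N)) : ℕ) : ℤ) = Y (i + h - N)) := by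
      intro i
      have hi := i.isLt
      by_cases hih : (i : ℕ) + h < N
      · refine Or.inl ⟨hih, Nat.mod_eq_of_lt hih, ?_⟩
        rw [Nat.mod_eq_of_lt hih, ← resid_sub_self]
        have h1 := hle _ hih
        have h2 := hlt _ hih
        exact coe_resid_of_mem (by omega) (by omega)
      · have hmod : ((i : ℕ) + h) % N = i + h - N := by
          rw [Nat.mod_eq_sub_mod (by omega), Nat.mod_eq_of_lt (by omega)]
        refine Or.inr ⟨by omega, hmod, ?_⟩
        rw [hmod]
        have h1 := hle (i + h - N) (by omega)
        have h2 := hlt (i + h - N) (by omega)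
        exact coe_resid_of_mem (by omega) (by omega)
    intro i
    rw [particle, ← Finset.orderEmbOfFin_unique x.2
      (f := fun i : Fin N => resid L (Y ((i + h) % N)))]
    · intro j
      exact hYx.mem _ (Nat.mod_lt _ j.pos)
    · intro j k hjk
      have hjk' : (j : ℕ) < k := hjk
      have hk := k.isLt
      rw [Fin.lt_def, ← Nat.cast_lt (α := ℤ)]
      rcases hval j with ⟨h1, -, h2⟩ | ⟨h1, -, h2⟩ <;>
        rcases hval k with ⟨h3, -, h4⟩ | ⟨h3, -, h4⟩ <;> rw [h2, h4]
      · have := (hYx.window (j + h) (k + h) (by omega) h3).1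
        omega
      · have := hle (j + h) h1
        have := hle (k + h - N) (by omega)
        omega
      · omega
      · exact (hYx.window (j + h - N) (k + h - N) (by omega) (by omega)).1
  refine ⟨(finRotate N ^ h)⁻¹, inv_mem (pow_mem (Subgroup.mem_zpowers _) _), fun j => ?_⟩
  rw [hf, ← coe_finRotate_pow, ← Equiv.Perm.mul_apply, mul_inv_cancel, Equiv.Perm.one_apply, hYZ]

lemma IsSplit.exists_isDisplacement {L : ℕ} [NeZero L] {Z : ℕ → ℤ} {A B : ℤ} {ℓ n r : ℕ}
    {x : Config L (ℓ + n + r)} {Γ : Finset (Fin L)} (h : IsSplit Z A B ℓ n r) (hx : IsLift x Z)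
    (hn : 0 < n)
    (hΓ : ∀ i < ℓ + n + r, resid L (Z i) ∈ Γ ↔ A ≤ Z i ∧ Z i ≤ B)
    (hl : (leftEnd Γ : ℤ) = A) (hr : (rightEnd Γ : ℤ) = B) :
    ∃ σ, IsDisplacement x Γ ℓ r σ (fun j => (A - (j + 1) - Z (ℓ - 1 - j)).toNat)
      (fun j => (Z (ℓ + n + j) - (B + (j + 1))).toNat) := by
  obtain ⟨σ, hσ, hσx⟩ := hx.exists_zpowers_finRotate
  have hL := Nat.pos_of_neZero L
  have hw := hx.window
  refine ⟨σ, hσ, ?_, ?_, ?_, ?_, ?_, ?_, ?_⟩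
  · rw [h.inter_eq_image hx hΓ]
    ext a
    simp only [hσx, Finset.mem_image, Finset.mem_Ico, Finset.mem_filter, Finset.mem_univ,
      true_and]
    constructor
    · rintro ⟨i, hi, rfl⟩
      exact ⟨⟨i, by omega⟩, by simp only; omega, rfl⟩
    · rintro ⟨i, hi, rfl⟩
      exact ⟨i, by omega, rfl⟩
  · intro j k hjk
    have hjk' : (j : ℕ) ≤ k := hjk
    have e := hw.sub_le_sub (i := ℓ - 1 - k) (j := ℓ - 1 - j) (by omega) (by omega)
    simp only
    omega
  · intro j k hjk
    have hjk' : (j : ℕ) ≤ k := hjk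
    have e := hw.sub_le_sub (i := ℓ + n + j) (j := ℓ + n + k) (by omega) (by omega)
    simp only
    omega
  · intro j
    have e1 := hw (ℓ - 1 - j) ℓ (by omega) (by omega)
    have e2 := h.mid ℓ le_rfl (by omega)
    omega
  · intro j
    have e1 := hw (ℓ + n - 1) (ℓ + n + j) (by omega) (by omega)
    have e2 := h.mid (ℓ + n - 1) (by omega) (by omega)
    omega
  · intro ζ j hζ
    have e3 := hw.sub_le_sub (i := ℓ - 1 - j) (j := ℓ - 1) (by omega) (by omega)
    have e4 := h.left (ℓ - 1) (by omega)
    rw [hσx, hl, show (ζ : ℕ) = ℓ - 1 - j by omega]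
    congr 1
    omega
  · intro i j hi
    have e3 := hw.sub_le_sub (i := ℓ + n) (j := ℓ + n + j) (by omega) (by omega)
    have e4 := h.right (ℓ + n) (by omega) (by omega)
    rw [hσx, hr, show (i : ℕ) = ℓ + n + j by omega]
    congr 1
    omega

/-! ### Closest droplets and shortest walks -/

section Main

variable {L N : ℕ} [NeZero L] {x : Config L N} {Γ : Finset (Fin L)} {A B : ℤ}

/-- If `x` is so close to the droplets that its particles in the short interval `Γ` cannot all be at
distance `L / 4` from their targets, then the distance to the droplets is attained by a lift of `x`
that does not cut `Γ`. -/
lemma exists_isLift_forall_mem_Icc (hN : 0 < N) (hA : 0 ≤ A) (hB : B < L)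
    (hΓ : ∀ k : Fin L, k ∈ Γ ↔ A ≤ (k : ℕ) ∧ ((k : ℕ) : ℤ) ≤ B)
    (hAB : 8 * (B - A) < L) (hNL : 16 * N ≤ L)
    (hk : 4 * distToDroplets x < (x.1 ∩ Γ).card * L) :
    ∃ Z m, IsLift x Z ∧ ∑ i ∈ Finset.range N, |Z i - (m + i)| ≤ (distToDroplets x : ℤ) ∧
      ∀ i < N, resid L (Z i) ∈ Γ → A ≤ Z i ∧ Z i ≤ B := by
  have hL : (0 : ℤ) < L := by exact_mod_cast Nat.pos_of_neZero L
  obtain ⟨Y, m, hY, hsum⟩ := exists_isLift_sum_le_distToDroplets hN (by omega) x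
  -- Translate such that `Z 0` lies in `(B - L, B]`.
  set t := -((B - Y 0) / L) with ht
  set Z : ℕ → ℤ := fun i => Y i - t * L with hZ
  have hZ0 : B - Z 0 = (B - Y 0) % L := by
    have := Int.emod_add_mul_ediv (B - Y 0) L
    rw [hZ, ht]
    linear_combination -this
  have hZx : IsLift x Z := hY.sub_mul t
  have h1 := Int.emod_nonneg (B - Y 0) hL.ne'
  have h2 := Int.emod_lt_of_pos (B - Y 0) hL
  have hsumZ : ∑ i ∈ Finset.range N, |Z i - (m - t * L + i)| ≤ (distToDroplets x : ℤ) := by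
    convert hsum using 3
    rw [hZ]
    ring
  refine ⟨Z, m - t * L, hZx, hsumZ, fun i hi hiΓ => ?_⟩
  refine hZx.mem_Icc_of_minimal (m := m - t * L) hN hA hB hΓ hAB hNL ?_ ?_ (by omega) (by omega)
    hi hiΓ
  · intro Z' m' hZ'
    exact hsumZ.trans (distToDroplets_le_sum hN (by omega) m' hZ')
  · have : (4 * distToDroplets x : ℤ) < (x.1 ∩ Γ).card * L := by exact_mod_cast hk
    omega

/-- The combinatorial core: if more than half of the particles of `x` lie in the short interval `Γ`
and `x` is not too far from the droplets, then the droplet centred at the middle particle of `x`, in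
the order in which `ℓ` particles are to the left of `Γ` and `r` to its right, is closest to `x`, and
some shortest walk from it to `x` passes through `(x ∩ Γ) ∪ b_{ℓ,r}`. -/
lemma exists_shortest_walk_through_boundaryConfig {n : ℕ} (hn : N < 2 * n)
    (hA : 0 ≤ A) (hB : B < L)
    (hΓ : ∀ k : Fin L, k ∈ Γ ↔ A ≤ (k : ℕ) ∧ ((k : ℕ) : ℤ) ≤ B)
    (hAB : 8 * (B - A) < L) (hNL : 16 * N ≤ L)
    (hl : (leftEnd Γ : ℤ) = A) (hr : (rightEnd Γ : ℤ) = B)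
    (hy : (x.1 ∩ Γ).card = n) (hk : 4 * distToDroplets x < n * L) :
    ∃ ℓ r : ℕ, ℓ + r = N - n ∧ ∃ i : Fin n, (i : ℕ) + 1 + ℓ = (N + 1) / 2 ∧
      (x.1 ∩ Γ).orderEmbOfFin hy i ∈ closestCenters x ∧
      ∃ c : Config L N, c.1 = droplet L N ((x.1 ∩ Γ).orderEmbOfFin hy i) ∧
      ∃ v : (configGraph L N).Walk c x, v.length = configDist c x ∧
      ∃ k₀ : ℕ, k₀ ≤ distToDroplets x ∧
        (v.getVert k₀).1 = x.1 ∩ Γ ∪ boundaryConfig Γ ℓ r ∧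
        ∃ (σ : Equiv.Perm (Fin N)) (χm : Fin ℓ → ℕ) (χp : Fin r → ℕ),
          IsDisplacement x Γ ℓ r σ χm χp ∧
          (distToDroplets x : ℤ) - (k₀ : ℤ) =
            ((∑ ζ, χm ζ : ℕ) : ℤ) + ((∑ ξ, χp ξ : ℕ) : ℤ) := by
  have hnN : n ≤ N := by
    have := Finset.card_le_card (Finset.inter_subset_left (s₁ := x.1) (s₂ := Γ))
    rwa [hy, x.2] at this
  have hN : 0 < N := by omega
  obtain ⟨Z, m, hx, hsum, huncut⟩ :=
    exists_isLift_forall_mem_Icc hN hA hB hΓ hAB hNL (by rwa [hy])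
  have hΓ' : ∀ i < N, resid L (Z i) ∈ Γ ↔ A ≤ Z i ∧ Z i ≤ B := by
    refine fun i hi => ⟨huncut i hi, fun h => ?_⟩
    rw [hΓ, coe_resid_of_mem (by omega) (by omega)]
    exact h
  have hcard : ((Finset.range N).filter fun i => A ≤ Z i ∧ Z i ≤ B).card = n := by
    rw [← hy, hx.card_inter]
    congr 1
    refine Finset.filter_congr fun i hi => ?_
    rw [hΓ' i (Finset.mem_range.1 hi)]
  have hAB' : A ≤ B := by
    obtain ⟨i, hi⟩ := Finset.card_pos.1 (hcard.symm ▸ (by omega : 0 < n))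
    have := (Finset.mem_filter.1 hi).2
    omega
  obtain ⟨ℓ, r, hsplit, h⟩ := hx.window.exists_isSplit hAB' hcard
  subst hsplit
  have hw := hx.window
  obtain ⟨p, hp⟩ : ∃ p, p = (ℓ + n + r - 1) / 2 := ⟨_, rfl⟩
  have hcenter : (x.1 ∩ Γ).orderEmbOfFin hy ⟨p - ℓ, by omega⟩ = resid L (Z p) := by
    rw [h.orderEmbOfFin_inter hx hA hB hΓ' hy]
    simp only
    congr 2
    omega
  -- The walk moves the particles from the droplet to the boundary configuration and on to `x`.
  obtain ⟨c, hc, hcl⟩ := exists_isLift_droplet hN (by omega) (L := L) (Z p - p)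
  rw [show Z p - p + (((ℓ + n + r : ℕ) : ℤ) - 1) / 2 = Z p by omega] at hc
  have hbw := h.isWindow_boundaryLift hw hAB' (by omega)
  have hbl := hbw.isLift_config
  obtain ⟨v₁, hv₁⟩ := hcl.exists_walk (by omega) (fun i hi j hj => by omega) hbl
  obtain ⟨v₂, hv₂⟩ := hbl.exists_walk (by omega) (fun i hi j hj => by
    have := h.boundaryLift_mem hAB' hi
    have := h.boundaryLift_mem hAB' hj
    omega) hx
  have hadd := h.sum_abs_add_sum_abs hw (p := p) (by omega) (by omega)
  rw [← hv₁, ← hv₂] at hadd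
  have hmed := hw.sum_abs_median_le m
  rw [← hp, ← hadd] at hmed
  have hlen : (v₁.append v₂).length = v₁.length + v₂.length := SimpleGraph.Walk.length_append _ _
  have h1 : configDist c x ≤ (v₁.append v₂).length := SimpleGraph.dist_le _
  have h2 : configDist c x = configDist x c := SimpleGraph.dist_comm
  have h3 := distToDroplets_le_configDist (x := x) hc
  obtain ⟨σ, hσ⟩ := h.exists_isDisplacement hx (by omega) hΓ' hl hr
  refine ⟨ℓ, r, by omega, ⟨p - ℓ, by omega⟩, by simp only; omega, ?_, c, ?_, v₁.append v₂,
    by omega, v₁.length, by omega, ?_, σ, _, _, hσ, ?_⟩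
  · rw [hcenter]
    exact ⟨c, hc, by omega⟩
  · rw [hcenter, hc]
  · rw [SimpleGraph.Walk.getVert_append, if_neg (lt_irrefl _), Nat.sub_self,
      SimpleGraph.Walk.getVert_zero]
    exact h.image_boundaryLift hx hΓ' hl hr
  · rw [← h.sum_abs_sub_boundaryLift hw, ← hv₂]
    omega

end Main

/-! ### Sectors and negligible configurations -/

/-- A small sector is an interval centred at `⌊(L - 1) / 2⌋`. -/
lemma exists_radius_sector {L : ℕ} [NeZero L] (hL : 2 ≤ L) {θ : ℝ} (h0 : 0 < θ)
    (h1 : θ < 1 / 16) :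
    ∃ R : ℕ, (R : ℝ) < θ * L ∧
      (leftEnd (sector L θ) : ℤ) = ((L - 1) / 2 : ℕ) - R ∧
      (rightEnd (sector L θ) : ℤ) = ((L - 1) / 2 : ℕ) + R ∧
      ∀ k : Fin L, k ∈ sector L θ ↔
        (((L - 1) / 2 : ℕ) : ℤ) - R ≤ (k : ℕ) ∧ ((k : ℕ) : ℤ) ≤ ((L - 1) / 2 : ℕ) + R := by
  have hL0 : (0 : ℝ) < L := by exact_mod_cast Nat.pos_of_neZero L
  have hpos : 0 < ⌈θ * L⌉₊ := Nat.ceil_pos.2 (by positivity)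
  have hlt : ∀ s : ℕ, (s : ℝ) < θ * L ↔ s ≤ ⌈θ * L⌉₊ - 1 := by
    intro s
    rw [← Nat.lt_ceil]
    omega
  set R := ⌈θ * L⌉₊ - 1
  have hR : (R : ℝ) < θ * L := (hlt R).2 le_rfl
  have hRL : 16 * R < L := by
    have : (16 * R : ℝ) < L := by nlinarith
    exact_mod_cast this
  have hmem : ∀ k : Fin L, k ∈ sector L θ ↔
      (((L - 1) / 2 : ℕ) : ℤ) - R ≤ (k : ℕ) ∧ ((k : ℕ) : ℤ) ≤ ((L - 1) / 2 : ℕ) + R := by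
    intro k
    rw [mem_sector_iff hL, ← Int.natCast_natAbs, Int.cast_natCast, hlt]
    omega
  have hleast : IsLeast {k | ∃ j ∈ sector L θ, (j : ℕ) = k} ((L - 1) / 2 - R) := by
    refine ⟨⟨⟨(L - 1) / 2 - R, by omega⟩, (hmem _).2 (by simp only; omega), rfl⟩, ?_⟩
    rintro _ ⟨j, hj, rfl⟩
    have := (hmem j).1 hj
    omega
  have hright : rightEnd (sector L θ) = (L - 1) / 2 + R := by
    apply le_antisymm
    · refine Finset.sup_le fun j hj => ?_
      have := (hmem j).1 hj
      omega
    · exact Finset.le_sup (f := fun j : Fin L => (j : ℕ)) (b := ⟨(L - 1) / 2 + R, by omega⟩)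
        ((hmem _).2 (by simp only; omega))
  refine ⟨R, hR, ?_, by rw [hright]; push_cast; rfl, hmem⟩
  rw [leftEnd, hleast.csInf_eq]
  omega

lemma resid_mem_sector {L : ℕ} [NeZero L] (hL : 2 ≤ L) {θ : ℝ} {z : ℤ} (h0 : 0 ≤ z) (h1 : z < L)
    {D : ℕ} (hz : |z - ((L - 1) / 2 : ℕ)| ≤ D) (hD : (D : ℝ) < θ * L) :
    resid L z ∈ sector L θ := by
  rw [mem_sector_iff hL, coe_resid_of_mem h0 h1]
  refine lt_of_le_of_lt ?_ hD
  exact_mod_cast hz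

/-- On long rings, if more than half of the particles, `n` of them, are at distance at least `L / 4`
from their targets in a droplet, then the configuration is negligible. -/
lemma rpow_three_halves_le {ε L N n : ℝ} (hε : 0 < ε) (hε' : ε < 1 / 16) (hL : (16 / ε) ^ 2 ≤ L)
    (hN : ε * L < N + 1) (hn : N < 2 * n) : 4 * L ^ (3 / 2 : ℝ) ≤ n * L := by
  have h16 : (256 : ℝ) ≤ 16 / ε := by
    rw [le_div_iff₀ hε]; linarith
  have hL0 : 0 < L := by nlinarith
  have hs : 16 / ε ≤ √L := Real.le_sqrt_of_sq_le hL
  rw [div_le_iff₀ hε] at hs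
  have hsq : √L * √L = L := Real.mul_self_sqrt hL0.le
  have hpow : L ^ (3 / 2 : ℝ) = L * √L := by
    rw [show (3 / 2 : ℝ) = 1 + 1 / 2 by norm_num, Real.rpow_add hL0, Real.rpow_one,
      Real.sqrt_eq_rpow]
  have h1 : 256 ≤ √L := by
    refine h16.trans (Real.le_sqrt_of_sq_le hL)
  have h2 : 16 * √L ≤ ε * L := by nlinarith
  rw [hpow]
  nlinarith

end XXZRing

theorem mainTheorem5 (ε : ℝ) (hε₀ : 0 < ε) (hε₁ : ε < 1 / 16) :
    ∃ L₀ : ℝ, 0 < L₀ ∧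
      ∀ θ : ℝ, ε < θ → θ < 1 / 16 →
      ∀ (L : ℕ) [NeZero L], L₀ ≤ (L : ℝ) →
      ∀ N : ℕ, N = ⌊ε * (L : ℝ)⌋₊ →
      ∀ n : ℕ, (N : ℝ) / 2 < (n : ℝ) → n < N →
      ∀ (y : Finset (Fin L)) (hy : y.card = n), y ⊆ XXZRing.sector L θ →
      ∀ x : XXZRing.Config L N, x ∉ XXZRing.negligible L N →
        x.1 ∩ XXZRing.sector L θ = y →
      ∃ ℓ r : ℕ, ℓ + r = N - n ∧
      -- the particle of `y` with (one-based) label `⌊(N + 1) / 2⌋ - ℓ`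
      ∃ i : Fin n, (i : ℕ) + 1 + ℓ = (N + 1) / 2 ∧
        y.orderEmbOfFin hy i ∈ XXZRing.closestCenters x ∧
        XXZRing.droplet L N (y.orderEmbOfFin hy i) ⊆ XXZRing.sector L (1 / 4 - ε / 2) ∧
        -- a shortest path `v` from the droplet `c` to `x`, at `y ∪ b` after `k₀` steps
        ∃ c : XXZRing.Config L N, c.1 = XXZRing.droplet L N (y.orderEmbOfFin hy i) ∧
        ∃ v : (XXZRing.configGraph L N).Walk c x, v.length = XXZRing.configDist c x ∧
        ∃ k₀ : ℕ, k₀ ≤ XXZRing.distToDroplets x ∧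
          (v.getVert k₀).1 = y ∪ XXZRing.boundaryConfig (XXZRing.sector L θ) ℓ r ∧
          y ∪ XXZRing.boundaryConfig (XXZRing.sector L θ) ℓ r ⊆
            XXZRing.sector L (1 / 4 - ε / 2) ∧
          ∃ (σ : Equiv.Perm (Fin N)) (χm : Fin ℓ → ℕ) (χp : Fin r → ℕ),
            XXZRing.IsDisplacement x (XXZRing.sector L θ) ℓ r σ χm χp ∧
            (XXZRing.distToDroplets x : ℤ) - (k₀ : ℤ) =
              ((∑ ζ, χm ζ : ℕ) : ℤ) + ((∑ ξ, χp ξ : ℕ) : ℤ) := by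
  refine ⟨(16 / ε) ^ 2, by positivity, ?_⟩
  intro θ hθ₀ hθ₁ L _ hL N hN n hn hnN y hy hyΓ x hx hxy
  have h16 : (256 : ℝ) ≤ 16 / ε := by
    rw [le_div_iff₀ hε₀]; linarith
  have hL1 : (2 : ℝ) ≤ L := by nlinarith
  have hL2 : 2 ≤ L := by exact_mod_cast hL1
  have hNle : (N : ℝ) ≤ ε * L := hN ▸ Nat.floor_le (by positivity)
  have hNlt : ε * L < N + 1 := hN ▸ Nat.lt_floor_add_one _
  have hNL : 16 * N ≤ L := by
    have : (16 * N : ℝ) ≤ L := by nlinarith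
    exact_mod_cast this
  have hn2 : (N : ℝ) < 2 * n := by linarith
  have hn2' : N < 2 * n := by exact_mod_cast hn2
  obtain ⟨R, hR, hl, hr, hmem⟩ := XXZRing.exists_radius_sector hL2 (hε₀.trans hθ₀) hθ₁
  have hRL : 16 * R < L := by
    have : (16 * R : ℝ) < L := by nlinarith
    exact_mod_cast this
  have hRN : ((R + N : ℕ) : ℝ) < (1 / 4 - ε / 2) * L := by
    push_cast
    nlinarith
  have hk : 4 * XXZRing.distToDroplets x < n * L := by
    have h1 : (XXZRing.distToDroplets x : ℝ) < (L : ℝ) ^ (3 / 2 : ℝ) := not_le.1 hx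
    have h2 := XXZRing.rpow_three_halves_le hε₀ hε₁ hL hNlt hn2
    have : (4 * XXZRing.distToDroplets x : ℝ) < n * L := by linarith
    exact_mod_cast this
  subst hxy
  obtain ⟨ℓ, r, hℓr, i, hi, hclose, c, hc, v, hv, k₀, hk₀, hvk, hσ⟩ :=
    XXZRing.exists_shortest_walk_through_boundaryConfig hn2' (by omega) (by omega) hmem (by omega)
      hNL hl hr hy hk
  refine ⟨ℓ, r, hℓr, i, hi, hclose, ?_, c, hc, v, hv, k₀, hk₀, hvk, ?_, hσ⟩
  · have hq := (hmem _).1 (hyΓ (Finset.orderEmbOfFin_mem _ hy i))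
    intro k hk
    obtain ⟨z, hz, rfl⟩ := Finset.mem_image.1 hk
    rw [Finset.mem_Icc] at hz
    refine XXZRing.resid_mem_sector hL2 (by omega) (by omega) (abs_le.2 ⟨?_, ?_⟩) hRN <;> omega
  · intro k hk
    rw [Finset.mem_union, XXZRing.boundaryConfig, hl, hr] at hk
    simp only [Finset.mem_union, Finset.mem_image, Finset.mem_Icc] at hk
    rcases hk with hk | ⟨j, hj, rfl⟩ | ⟨j, hj, rfl⟩
    · have hkm := (hmem k).1 (hyΓ hk)
      rw [← XXZRing.resid_natCast_coe k]
      refine XXZRing.resid_mem_sector hL2 (by omega) (by omega) (abs_le.2 ⟨?_, ?_⟩) hRN <;> omega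
    · refine XXZRing.resid_mem_sector hL2 (by omega) (by omega) (abs_le.2 ⟨?_, ?_⟩) hRN <;> omega
    · refine XXZRing.resid_mem_sector hL2 (by omega) (by omega) (abs_le.2 ⟨?_, ?_⟩) hRN <;> omega
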